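/- Let $\Lambda=\mathbb C[p_1,p_2,p_3,\ldots]$ be the ring of symmetric functions, where $p_k$ is the $k$-th power sum, let $s_\lambda\in\Lambda$ be the Schur function of the partition $\lambda$, and let $|\lambda|$ be the sum of the parts of $\lambda$. The Bernstein vertex operator is $$B(t)=\sum_{n\in\mathbb Z}B_nt^n=\exp\Bigl(\sum_{k\ge1}\frac{t^k}{k}\,p_k\Bigr)\exp\Bigl(-\sum_{k\ge1}t^{-k}\frac{\partial}{\partial p_k}\Bigr),$$ where $p_k$ acts on $\Lambda$ by multiplication; it sends every element of $\Lambda$ to a formal Laurent series in $t$ with coefficients in $\Lambda$. The code of a partition $\lambda$ is the doubly infinite word in the letters U and R, taken up to shift, that is read off as follows. Place the Young diagram of $\lambda$ (rows of lengths $\lambda_1\ge\lambda_2\ge\cdots$ from top to bottom) top and left aligned in the fourth quadrant. Walk up the negative $y$-axis to the bottom of the diagram, then along its lower right boundary, then to the right along the positive $x$-axis, and write U for every unit step up and R for every unit step to the right. For $i\ge1$ let $\lambda^{(i)}$ be the partition whose code is obtained from that of $\lambda$ by turning the $i$-th R from the left into a U. **Theorem (Carrell–Goulden).** For every partition $\lambda$,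 the family on the right is summable in the Laurent series over $\Lambda$, and $$B(t)\,s_\lambda=\sum_{i\ge1}(-1)^{|\lambda|-|\lambda^{(i)}|+i-1}\,t^{|\lambda^{(i)}|-|\lambda|}\,s_{\lambda^{(i)}}.$$ -/

import Mathlib

noncomputable section

namespace CarrellGoulden

/-! ### The ring of symmetric functions and the Bernstein operator -/

/-- The ring of symmetric functions `ℂ[p₁, p₂, p₃, …]`; the variable `X k` is the power sum
`p_k`, for `k ≥ 1`. -/
abbrev SymFun : Type := MvPolynomial ℕ+ ℂ

/-- The exponential `∑_m a ^ m / m!` of a formal power series `a` with zero constant term, over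
a `ℂ`-algebra that need not be commutative.  As `a ^ m` is divisible by `X ^ m`, only the terms
with `m ≤ n` contribute to the coefficient of `X ^ n`. -/
def formalExp {A : Type*} [Ring A] [Algebra ℂ A] (a : PowerSeries A) : PowerSeries A :=
  PowerSeries.mk fun n =>
    ∑ m ∈ Finset.range (n + 1), ((m.factorial : ℂ)⁻¹) • PowerSeries.coeff n (a ^ m)

/-- The series `∑_{k ≥ 1} (t ^ k / k) p_k`. -/
def raisingExponent : PowerSeries SymFun :=
  PowerSeries.mk fun k =>
    if hk : 0 < k then ((k : ℂ)⁻¹) • (MvPolynomial.X (k.toPNat hk) : SymFun) else 0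

/-- The series `exp (∑_{k ≥ 1} (t ^ k / k) p_k)` in `t`. -/
def raisingSeries : PowerSeries SymFun := formalExp raisingExponent

/-- The series `-∑_{k ≥ 1} u ^ k ∂/∂p_k` with operator coefficients; here `u` is `t⁻¹`. -/
def loweringExponent : PowerSeries (Module.End ℂ SymFun) :=
  PowerSeries.mk fun k =>
    if hk : 0 < k then
      -((MvPolynomial.pderiv (k.toPNat hk) : Derivation ℂ SymFun SymFun) :
          SymFun →ₗ[ℂ] SymFun)
    else 0

/-- The series `exp (-∑_{k ≥ 1} u ^ k ∂/∂p_k)` with operator coefficients; here `u` is `t⁻¹`. -/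
def loweringSeries : PowerSeries (Module.End ℂ SymFun) := formalExp loweringExponent

theorem coeff_loweringExponent_pow_eq_zero (m : ℕ) :
    ∀ (d : ℕ) (f : SymFun),
      (∀ s ∈ f.support, Finsupp.weight (fun k : ℕ+ => (k : ℕ)) s ≤ d) →
      ∀ n, d < n → PowerSeries.coeff n (loweringExponent ^ m) f = 0 := by
  induction m with
  | zero =>
    intro d f _ n hn
    rw [pow_zero, PowerSeries.coeff_one, if_neg (by omega)]
    rfl
  | succ m ih =>
    intro d f hf n hn
    rw [pow_succ, PowerSeries.coeff_mul, LinearMap.sum_apply]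
    refine Finset.sum_eq_zero ?_
    rintro ⟨a, b⟩ hab
    have hab : a + b = n := by simpa using hab
    simp only
    rw [Module.End.mul_apply]
    have key : ∀ hb : 0 < b, ∀ s ∈ (MvPolynomial.pderiv (b.toPNat hb) f).support,
        Finsupp.weight (fun k : ℕ+ => (k : ℕ)) s + b ≤ d := by
      intro hb s hs
      rw [MvPolynomial.mem_support_iff, MvPolynomial.coeff_pderiv] at hs
      have h2 := hf _ (MvPolynomial.mem_support_iff.2 (left_ne_zero_of_mul hs))
      rw [map_add, Finsupp.weight_single] at h2
      simp only [smul_eq_mul, one_mul] at h2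
      exact h2
    by_cases hb : 0 < b
    · simp only [loweringExponent, PowerSeries.coeff_mk, dif_pos hb]
      rw [LinearMap.neg_apply, map_neg, neg_eq_zero]
      by_cases h0 : (MvPolynomial.pderiv (b.toPNat hb) f) = 0
      · erw [h0, map_zero]
      · obtain ⟨s, hs⟩ := Finset.nonempty_of_ne_empty
          (fun h => h0 (MvPolynomial.support_eq_empty.1 h))
        have := key hb s hs
        exact ih (d - b) _ (fun s hs => by have := key hb s hs; omega) a (by omega)
    · simp only [loweringExponent, PowerSeries.coeff_mk, dif_neg hb]
      simp

theorem exists_coeff_loweringSeries_eq_zero (f : SymFun) :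
    ∃ d : ℕ, ∀ n, d < n → PowerSeries.coeff n loweringSeries f = 0 := by
  refine ⟨f.support.sup (Finsupp.weight (fun k : ℕ+ => (k : ℕ))), fun n hn => ?_⟩
  rw [loweringSeries, formalExp, PowerSeries.coeff_mk, LinearMap.sum_apply]
  refine Finset.sum_eq_zero fun m _ => ?_
  rw [LinearMap.smul_apply, coeff_loweringExponent_pow_eq_zero m _ f
    (fun s hs => Finset.le_sup (f := Finsupp.weight (fun k : ℕ+ => (k : ℕ))) hs) n hn, smul_zero]

/-- The result of applying `exp (-∑_{k ≥ 1} t ^ (-k) ∂/∂p_k)` to `f`: the coefficient of `t ^ z`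
is that of `u ^ (-z)` in `loweringSeries`, applied to `f`. -/
def lowering (f : SymFun) : LaurentSeries SymFun :=
  HahnSeries.ofSuppBddBelow
    (fun z : ℤ => if z ≤ 0 then PowerSeries.coeff (-z).toNat loweringSeries f else 0) (by
      obtain ⟨d, hd⟩ := exists_coeff_loweringSeries_eq_zero f
      refine ⟨-(d : ℤ), fun z hz => ?_⟩
      by_contra h
      apply hz
      simp only
      rw [if_pos (by omega), hd _ (by omega)])

/-- The Bernstein vertex operator
`B(t) = exp (∑_{k ≥ 1} (t ^ k / k) p_k) exp (-∑_{k ≥ 1} t ^ (-k) ∂/∂p_k)`, applied to `f`.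
The first exponential acts by multiplication.  The result is a Laurent series in `t`, and its
coefficient of `t ^ n` is `B_n f`. -/
def bernstein (f : SymFun) : LaurentSeries SymFun :=
  HahnSeries.ofPowerSeries ℤ SymFun raisingSeries * lowering f

/-! ### Schur functions -/

/-- The complete homogeneous symmetric function `h_n`, with `h_n = 0` for `n < 0`; the generating
function of the `h_n` is `exp (∑_{k ≥ 1} (t ^ k / k) p_k)`. -/
def complete (n : ℤ) : SymFun :=
  if 0 ≤ n then PowerSeries.coeff n.toNat raisingSeries else 0

/-- The Schur function `s_μ = det (h_{μ_i - i + j})`, a determinant of size the number of rows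
of `μ`. -/
def schur (μ : YoungDiagram) : SymFun :=
  (Matrix.of fun i j : Fin (μ.colLen 0) =>
    complete ((μ.rowLen i : ℤ) - (i : ℤ) + (j : ℤ))).det

/-! The image of `schur μ` under `p_k ↦ x₁ ^ k + ⋯ + x_n ^ k` is the quotient of alternants
`det (x_i ^ (μ_j + n - j)) / det (x_i ^ (n - j))` (`schur_eq_alternant` below), for every `n` that
is at least the number of rows of `μ`. -/

theorem coeff_formalExp {A : Type*} [Ring A] [Algebra ℂ A] {a : PowerSeries A}
    (ha : PowerSeries.constantCoeff a = 0) {n N : ℕ} (hN : n ≤ N) :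
    PowerSeries.coeff n (formalExp a) =
      ∑ m ∈ Finset.range (N + 1), ((m.factorial : ℂ)⁻¹) • PowerSeries.coeff n (a ^ m) := by
  have hz : ∀ m n : ℕ, n < m → PowerSeries.coeff n (a ^ m) = 0 := by
    intro m
    induction m with
    | zero => intro n hn; omega
    | succ m ih =>
      intro n hn
      rw [pow_succ, PowerSeries.coeff_mul]
      refine Finset.sum_eq_zero ?_
      rintro ⟨i, j⟩ hij
      have hij : i + j = n := by simpa using hij
      rcases Nat.eq_zero_or_pos j with rfl | hj
      · simp only
        rw [PowerSeries.coeff_zero_eq_constantCoeff_apply, ha, mul_zero]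
      · simp only
        rw [ih i (by omega), zero_mul]
  rw [formalExp, PowerSeries.coeff_mk]
  refine Finset.sum_subset (Finset.range_mono (by omega)) fun m _ hm => ?_
  rw [Finset.mem_range] at hm
  rw [hz m n (by omega), smul_zero]

theorem derivative_formalExp {A : Type*} [CommRing A] [Algebra ℂ A] {a : PowerSeries A}
    (ha : PowerSeries.constantCoeff a = 0) :
    PowerSeries.derivative A (formalExp a) =
      PowerSeries.derivative A a * formalExp a := by
  ext n
  rw [PowerSeries.coeff_derivative, coeff_formalExp ha (le_refl (n + 1)), PowerSeries.coeff_mul]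
  have h1 : ∀ p ∈ Finset.HasAntidiagonal.antidiagonal n,
      PowerSeries.coeff p.1 (PowerSeries.derivative A a) * PowerSeries.coeff p.2 (formalExp a) =
      ∑ m ∈ Finset.range (n + 1), ((m.factorial : ℂ)⁻¹) •
        (PowerSeries.coeff p.1 (PowerSeries.derivative A a) * PowerSeries.coeff p.2 (a ^ m)) := by
    intro p hp
    have hp : p.1 + p.2 = n := by simpa using hp
    rw [coeff_formalExp ha (show p.2 ≤ n by omega), Finset.mul_sum]
    exact Finset.sum_congr rfl fun m _ => by rw [mul_smul_comm]
  rw [Finset.sum_congr rfl h1, Finset.sum_comm, Finset.sum_range_succ']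
  have h0 : PowerSeries.coeff (n + 1) (a ^ 0) = 0 := by
    rw [pow_zero, PowerSeries.coeff_one, if_neg (by omega)]
  rw [h0, smul_zero, add_zero, Finset.sum_mul]
  refine Finset.sum_congr rfl fun m _ => ?_
  rw [← Finset.smul_sum, ← PowerSeries.coeff_mul, smul_mul_assoc]
  have h2 := PowerSeries.coeff_derivative (R := A) (a ^ (m + 1)) n
  rw [← h2, PowerSeries.derivative_pow, Nat.add_sub_cancel, Nat.factorial_succ]
  have h3 : ((m + 1 : ℕ) : PowerSeries A) * a ^ m * PowerSeries.derivative A a =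
      ((m + 1 : ℕ) : ℂ) • (PowerSeries.derivative A a * a ^ m) := by
    rw [Nat.cast_smul_eq_nsmul, nsmul_eq_mul]; ring
  have h4 : ∀ (z : ℂ) (f : PowerSeries A),
      PowerSeries.coeff n (z • f) = z • PowerSeries.coeff n f := fun z f => rfl
  rw [h3, h4, smul_smul]
  congr 1
  have h5 : ((m + 1 : ℕ) : ℂ) ≠ 0 := by exact_mod_cast Nat.succ_ne_zero m
  rw [Nat.cast_mul, mul_inv, mul_right_comm, inv_mul_cancel₀ h5, one_mul]

theorem constantCoeff_formalExp {A : Type*} [Ring A] [Algebra ℂ A] (a : PowerSeries A) :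
    PowerSeries.constantCoeff (formalExp a) = 1 := by
  rw [← PowerSeries.coeff_zero_eq_constantCoeff_apply, formalExp, PowerSeries.coeff_mk]
  simp

/-- The specialization `p_k ↦ x₁ ^ k + ⋯ + x_n ^ k`. -/
def specialize (n : ℕ) : SymFun →ₐ[ℂ] MvPolynomial (Fin n) ℂ :=
  MvPolynomial.aeval fun k : ℕ+ => MvPolynomial.psum (Fin n) ℂ k

theorem constantCoeff_raisingExponent : PowerSeries.constantCoeff raisingExponent = 0 := by
  rw [← PowerSeries.coeff_zero_eq_constantCoeff_apply, raisingExponent, PowerSeries.coeff_mk]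
  simp

theorem derivative_raisingSeries : PowerSeries.derivative SymFun raisingSeries =
    PowerSeries.mk (fun k => (MvPolynomial.X k.succPNat : SymFun)) * raisingSeries := by
  rw [raisingSeries, derivative_formalExp constantCoeff_raisingExponent]
  congr 1
  ext1 k
  rw [PowerSeries.coeff_derivative, raisingExponent, PowerSeries.coeff_mk, PowerSeries.coeff_mk,
    dif_pos (Nat.succ_pos k)]
  have h5 : ((k + 1 : ℕ) : ℂ) ≠ 0 := by exact_mod_cast Nat.succ_ne_zero k
  have h6 : ((k : SymFun) + 1) = MvPolynomial.C ((k + 1 : ℕ) : ℂ) := by simp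
  rw [h6, mul_comm, ← MvPolynomial.smul_eq_C_mul, smul_smul, mul_inv_cancel₀ h5, one_smul]
  rfl

theorem coeff_prod_eq_zero {K ι : Type*} [CommRing K] (x : ι → K) (s : Finset ι) :
    ∀ m, s.card < m →
      PowerSeries.coeff m (∏ i ∈ s, (1 - PowerSeries.C (x i) * PowerSeries.X)) = 0 := by
  classical
  induction s using Finset.induction_on with
  | empty =>
    intro m hm
    rw [Finset.prod_empty, PowerSeries.coeff_one, if_neg (by simpa using hm.ne')]
  | insert i s hi ih =>
    intro m hm
    rw [Finset.card_insert_of_notMem hi] at hm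
    obtain ⟨m, rfl⟩ : ∃ q, m = q + 1 := ⟨m - 1, by omega⟩
    rw [Finset.prod_insert hi, sub_mul, one_mul, map_sub, ih _ (by omega), mul_assoc,
      PowerSeries.coeff_C_mul, PowerSeries.coeff_succ_X_mul, ih _ (by omega), mul_zero, sub_zero]

theorem geom_mul {K : Type*} [CommRing K] (x : K) :
    (1 - PowerSeries.C x * PowerSeries.X) * PowerSeries.mk (fun k => x ^ k) = 1 := by
  ext m
  rw [sub_mul, one_mul, mul_assoc, map_sub, PowerSeries.coeff_C_mul]
  cases m with
  | zero => simp
  | succ m =>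
    rw [PowerSeries.coeff_succ_X_mul, PowerSeries.coeff_mk, PowerSeries.coeff_mk,
      PowerSeries.coeff_one, if_neg (by omega), pow_succ']
    ring

theorem derivative_prod {K ι : Type*} [CommRing K] (x : ι → K) (s : Finset ι) :
    PowerSeries.derivative K (∏ i ∈ s, (1 - PowerSeries.C (x i) * PowerSeries.X)) =
      -((∏ i ∈ s, (1 - PowerSeries.C (x i) * PowerSeries.X)) *
        PowerSeries.mk fun k => ∑ i ∈ s, x i ^ (k + 1)) := by
  classical
  induction s using Finset.induction_on with
  | empty =>
    have : (PowerSeries.mk fun _ : ℕ => (0 : K)) = 0 := by ext; simp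
    simp [this]
  | insert i s hi ih =>
    have h1 : (PowerSeries.mk fun k => ∑ j ∈ insert i s, x j ^ (k + 1)) =
        PowerSeries.C (x i) * PowerSeries.mk (fun k => x i ^ k) +
          PowerSeries.mk fun k => ∑ j ∈ s, x j ^ (k + 1) := by
      ext k
      rw [map_add, PowerSeries.coeff_C_mul]
      simp only [PowerSeries.coeff_mk]
      rw [Finset.sum_insert hi, pow_succ']
    have h2 := geom_mul (x i)
    have h3 : PowerSeries.derivative K (1 - PowerSeries.C (x i) * PowerSeries.X) =
        -PowerSeries.C (x i) := by
      rw [map_sub, Derivation.leibniz, PowerSeries.derivative_C, PowerSeries.derivative_X]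
      simp
    rw [Finset.prod_insert hi, Derivation.leibniz, ih, h3, h1, smul_eq_mul, smul_eq_mul]
    linear_combination (PowerSeries.C (x i) *
      ∏ i ∈ s, (1 - PowerSeries.C (x i) * PowerSeries.X)) * h2

theorem prod_mul_map_raisingSeries (n : ℕ) :
    (∏ i : Fin n, (1 - PowerSeries.C (MvPolynomial.X i : MvPolynomial (Fin n) ℂ) *
      PowerSeries.X)) * PowerSeries.map (specialize n : SymFun →+* MvPolynomial (Fin n) ℂ) raisingSeries = 1 := by
  have hd : PowerSeries.derivative (MvPolynomial (Fin n) ℂ)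
      (PowerSeries.map (specialize n : SymFun →+* MvPolynomial (Fin n) ℂ) raisingSeries) =
      (PowerSeries.mk fun k => ∑ i : Fin n, (MvPolynomial.X i) ^ (k + 1)) *
        PowerSeries.map (specialize n : SymFun →+* MvPolynomial (Fin n) ℂ) raisingSeries := by
    have h1 : PowerSeries.derivative (MvPolynomial (Fin n) ℂ)
        (PowerSeries.map (specialize n : SymFun →+* MvPolynomial (Fin n) ℂ) raisingSeries) =
        PowerSeries.map (specialize n : SymFun →+* MvPolynomial (Fin n) ℂ)
          (PowerSeries.derivative SymFun raisingSeries) := by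
      ext1 k
      simp [PowerSeries.coeff_derivative]
    rw [h1, derivative_raisingSeries, map_mul]
    congr 1
    ext1 k
    rw [PowerSeries.coeff_map, PowerSeries.coeff_mk, PowerSeries.coeff_mk]
    simp [specialize, MvPolynomial.psum]
  refine PowerSeries.derivative.ext ?_ ?_
  · rw [Derivation.leibniz, hd, derivative_prod, smul_eq_mul, smul_eq_mul,
      PowerSeries.derivative_one]
    ring
  · have h2 : PowerSeries.constantCoeff
        (PowerSeries.map (specialize n : SymFun →+* MvPolynomial (Fin n) ℂ) raisingSeries) = 1 := by
      rw [← PowerSeries.coeff_zero_eq_constantCoeff_apply, PowerSeries.coeff_map,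
        PowerSeries.coeff_zero_eq_constantCoeff_apply, raisingSeries, constantCoeff_formalExp,
        map_one]
    rw [map_mul, h2, map_prod]
    simp

/-- Every power of `x_k` is a combination of complete symmetric functions of `x₁, …, x_n`, with
coefficients that are elementary symmetric functions of the other variables, up to sign. -/
theorem pow_eq_sum (n : ℕ) (k : Fin n) (a : ℕ) :
    (MvPolynomial.X k : MvPolynomial (Fin n) ℂ) ^ a =
      ∑ j : Fin n, PowerSeries.coeff (n - 1 - (j : ℕ))
        (∏ i ∈ Finset.univ.erase k, (1 - PowerSeries.C (MvPolynomial.X i :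
          MvPolynomial (Fin n) ℂ) * PowerSeries.X)) *
        specialize n (complete ((a : ℤ) - (n : ℤ) + 1 + (j : ℤ))) := by
  set Q := ∏ i ∈ Finset.univ.erase k, (1 - PowerSeries.C (MvPolynomial.X i :
          MvPolynomial (Fin n) ℂ) * PowerSeries.X) with hQ
  have h1 := prod_mul_map_raisingSeries n
  rw [← Finset.mul_prod_erase _ _ (Finset.mem_univ k), ← hQ] at h1
  have h2 := geom_mul (MvPolynomial.X k : MvPolynomial (Fin n) ℂ)
  have h3 : Q * PowerSeries.map (specialize n : SymFun →+* MvPolynomial (Fin n) ℂ) raisingSeries =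
      PowerSeries.mk fun m => (MvPolynomial.X k : MvPolynomial (Fin n) ℂ) ^ m := by
    linear_combination (PowerSeries.mk fun m =>
      (MvPolynomial.X k : MvPolynomial (Fin n) ℂ) ^ m) * h1 -
      (Q * PowerSeries.map (specialize n : SymFun →+* MvPolynomial (Fin n) ℂ) raisingSeries) * h2
  have h4 := congrArg (PowerSeries.coeff a) h3
  rw [PowerSeries.coeff_mk] at h4
  rw [← h4, PowerSeries.coeff_mul, Finset.Nat.sum_antidiagonal_eq_sum_range_succ
    (fun p q => PowerSeries.coeff p Q * PowerSeries.coeff q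
      (PowerSeries.map (specialize n : SymFun →+* MvPolynomial (Fin n) ℂ) raisingSeries))]
  have h5 : ∀ m, n - 1 < m → PowerSeries.coeff m Q = 0 := fun m hm => by
    refine coeff_prod_eq_zero _ _ m ?_
    rw [Finset.card_erase_of_mem (Finset.mem_univ k)]
    simpa using hm
  have hn : 0 < n := k.pos
  let G : ℕ → MvPolynomial (Fin n) ℂ := fun p => PowerSeries.coeff p Q *
    specialize n (complete ((a : ℤ) - (p : ℤ)))
  have h6 : ∀ p ∈ Finset.range (a + 1), PowerSeries.coeff p Q * PowerSeries.coeff (a - p)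
      (PowerSeries.map (specialize n : SymFun →+* MvPolynomial (Fin n) ℂ) raisingSeries) = G p := by
    intro p hp
    rw [Finset.mem_range] at hp
    simp only [G, complete]
    rw [if_pos (by omega), PowerSeries.coeff_map]
    have : ((a : ℤ) - (p : ℤ)).toNat = a - p := by omega
    rw [this]
    rfl
  have h7 : ∀ j : Fin n, PowerSeries.coeff (n - 1 - (j : ℕ)) Q *
      specialize n (complete ((a : ℤ) - (n : ℤ) + 1 + (j : ℤ))) = G (n - 1 - (j : ℕ)) := by
    intro j
    have hj := j.isLt
    have : (a : ℤ) - (n : ℤ) + 1 + (j : ℤ) = (a : ℤ) - ((n - 1 - (j : ℕ) : ℕ) : ℤ) := by omega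
    simp only [G]
    rw [this]
  rw [Finset.sum_congr rfl h6, Finset.sum_congr rfl fun j _ => h7 j,
    Fin.sum_univ_eq_sum_range (fun j => G (n - 1 - j)), Finset.sum_range_reflect]
  have h8 : ∀ N, n ≤ N → a + 1 ≤ N → (∑ p ∈ Finset.range (a + 1), G p = ∑ p ∈ Finset.range N, G p) ∧
      (∑ p ∈ Finset.range n, G p = ∑ p ∈ Finset.range N, G p) := by
    intro N h1 h2
    refine ⟨Finset.sum_subset (Finset.range_mono h2) fun p _ hp => ?_,
      Finset.sum_subset (Finset.range_mono h1) fun p _ hp => ?_⟩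
    · rw [Finset.mem_range] at hp
      simp only [G, complete]
      rw [if_neg (by omega), map_zero, mul_zero]
    · rw [Finset.mem_range] at hp
      simp only [G]
      rw [h5 p (by omega), zero_mul]
  obtain ⟨e1, e2⟩ := h8 (max n (a + 1)) (le_max_left _ _) (le_max_right _ _)
  rw [e1, e2]

theorem complete_zero : complete 0 = 1 := by
  rw [complete, if_pos le_rfl, Int.toNat_zero, PowerSeries.coeff_zero_eq_constantCoeff_apply,
    raisingSeries, constantCoeff_formalExp]

theorem complete_neg {z : ℤ} (hz : z < 0) : complete z = 0 := by
  rw [complete, if_neg (by omega)]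

theorem det_complete_sub (n : ℕ) :
    (Matrix.of fun i j : Fin n => complete ((j : ℤ) - (i : ℤ))).det = 1 := by
  rw [Matrix.det_of_isUpperTriangular]
  · refine Finset.prod_eq_one fun i _ => ?_
    rw [Matrix.of_apply, sub_self, complete_zero]
  · intro i j hij
    have : (j : ℕ) < (i : ℕ) := hij
    exact complete_neg (by omega)

/-- The determinant that defines `schur μ` may be enlarged by zero rows of `μ`. -/
theorem schur_eq_det (μ : YoungDiagram) {n : ℕ} (hn : μ.colLen 0 ≤ n) :
    schur μ = (Matrix.of fun i j : Fin n =>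
      complete ((μ.rowLen i : ℤ) - (i : ℤ) + (j : ℤ))).det := by
  obtain ⟨d, rfl⟩ := Nat.exists_eq_add_of_le hn
  rw [← Matrix.det_submatrix_equiv_self finSumFinEquiv, ← Matrix.fromBlocks_toBlocks
    (Matrix.submatrix _ _ _)]
  have hz : ∀ r, μ.colLen 0 ≤ r → μ.rowLen r = 0 := by
    intro r hr
    by_contra h
    have h1 : (r, 0) ∈ μ := YoungDiagram.mem_iff_lt_rowLen.2 (Nat.pos_of_ne_zero h)
    have := YoungDiagram.mem_iff_lt_colLen.1 h1
    omega
  have h21 : (Matrix.submatrix (Matrix.of fun i j : Fin (μ.colLen 0 + d) =>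
      complete ((μ.rowLen i : ℤ) - (i : ℤ) + (j : ℤ))) finSumFinEquiv finSumFinEquiv).toBlocks₂₁
      = 0 := by
    ext1 i j
    simp only [Matrix.toBlocks₂₁, Matrix.of_apply, Matrix.submatrix_apply,
      finSumFinEquiv_apply_right, finSumFinEquiv_apply_left, Fin.val_natAdd, Fin.val_castAdd,
      Matrix.zero_apply]
    rw [hz _ (by omega)]
    refine complete_neg ?_
    have := j.isLt
    push_cast
    omega
  have h22 : (Matrix.submatrix (Matrix.of fun i j : Fin (μ.colLen 0 + d) =>
      complete ((μ.rowLen i : ℤ) - (i : ℤ) + (j : ℤ))) finSumFinEquiv finSumFinEquiv).toBlocks₂₂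
      = Matrix.of fun i j : Fin d => complete ((j : ℤ) - (i : ℤ)) := by
    ext1 i j
    simp only [Matrix.toBlocks₂₂, Matrix.of_apply, Matrix.submatrix_apply,
      finSumFinEquiv_apply_right, Fin.val_natAdd]
    rw [hz _ (by omega)]
    congr 1
    push_cast
    ring
  rw [h21, h22, Matrix.det_fromBlocks_zero₂₁, det_complete_sub, mul_one]
  rfl

theorem schur_eq_alternant (μ : YoungDiagram) (n : ℕ) (hn : μ.colLen 0 ≤ n) :
    specialize n (schur μ) *
      (Matrix.of fun i j : Fin n =>
        (MvPolynomial.X i : MvPolynomial (Fin n) ℂ) ^ (n - 1 - (j : ℕ))).det =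
      (Matrix.of fun i j : Fin n =>
        (MvPolynomial.X i : MvPolynomial (Fin n) ℂ) ^ (μ.rowLen j + (n - 1 - (j : ℕ)))).det := by
  let M : Matrix (Fin n) (Fin n) (MvPolynomial (Fin n) ℂ) := Matrix.of fun k j =>
    PowerSeries.coeff (n - 1 - (j : ℕ)) (∏ i ∈ Finset.univ.erase k,
      (1 - PowerSeries.C (MvPolynomial.X i : MvPolynomial (Fin n) ℂ) * PowerSeries.X))
  have key : ∀ f : ℕ → ℕ, (Matrix.of fun i j : Fin n =>
      (MvPolynomial.X i : MvPolynomial (Fin n) ℂ) ^ (f j + (n - 1 - (j : ℕ)))).det =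
      M.det * specialize n (Matrix.of fun i j : Fin n =>
        complete ((f i : ℤ) - (i : ℤ) + (j : ℤ))).det := by
    intro f
    rw [AlgHom.map_det, ← Matrix.det_transpose (AlgHom.mapMatrix _ _), ← Matrix.det_mul]
    congr 1
    ext1 k i
    rw [Matrix.of_apply, pow_eq_sum, Matrix.mul_apply]
    refine Finset.sum_congr rfl fun j _ => ?_
    simp only [M, Matrix.of_apply, Matrix.transpose_apply, AlgHom.mapMatrix_apply,
      Matrix.map_apply]
    congr 3
    have := i.isLt
    omega
  have h0 := key (fun _ => 0)
  simp only [zero_add, Nat.cast_zero, zero_sub] at h0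
  have h1 : (Matrix.of fun i j : Fin n => complete (-(i : ℤ) + (j : ℤ))).det = 1 := by
    rw [← det_complete_sub n]
    congr 2
    ext1 i
    ext1 j
    congr 1
    ring
  rw [h0, h1, map_one, mul_one, key, schur_eq_det μ hn, mul_comm]


/-! ### Codes of partitions -/

/-- The letters of a code: a unit step up or a unit step to the right. -/
inductive Step : Type
  | U : Step
  | R : Step

open Classical in
/-- The code of a partition.  Put the Young diagram top and left aligned into the fourth quadrant
and walk up the negative `y`-axis, along the lower right boundary of the diagram and out along the
positive `x`-axis.  Every step increases `x + y` by one, and the letter at place `z` is that of the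
step which starts on the line `x + y = z`.  The vertical edge at the end of row `r = 0, 1, 2, …`
starts at `(μ_r, -r - 1)`. -/
def code (μ : YoungDiagram) (z : ℤ) : Step :=
  if ∃ r : ℕ, z = (μ.rowLen r : ℤ) - (r : ℤ) - 1 then Step.U else Step.R

/-- `ν` arises from `μ` by turning the `i`-th `R` from the left in the code of `μ` into a `U`.
A code is a doubly infinite word without a marked place, so that two words are identified when
they differ by a shift. -/
def IsTurn (μ : YoungDiagram) (i : ℕ+) (ν : YoungDiagram) : Prop :=
  ∃ z : ℤ, code μ z = Step.R ∧ {y : ℤ | y ≤ z ∧ code μ y = Step.R}.encard = ((i : ℕ) : ℕ∞) ∧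
    ∃ c : ℤ, ∀ y : ℤ, code ν y = Function.update (code μ) z Step.U (y + c)

theorem code_eq_U_iff (μ : YoungDiagram) (z : ℤ) :
    code μ z = Step.U ↔ ∃ r : ℕ, z = (μ.rowLen r : ℤ) - (r : ℤ) - 1 := by
  unfold code
  split_ifs with h <;> simp [h]

theorem code_ne_U_iff (μ : YoungDiagram) (z : ℤ) : code μ z ≠ Step.U ↔ code μ z = Step.R := by
  cases code μ z <;> simp

/-- The horizontal edge at the bottom of column `c = 0, 1, 2, …` starts at `(c, -μ'_c)`. -/
theorem code_eq_R_iff (μ : YoungDiagram) (z : ℤ) :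
    code μ z = Step.R ↔ ∃ c : ℕ, z = (c : ℤ) - (μ.colLen c : ℤ) := by
  have hmem : ∀ r c : ℕ, c < μ.rowLen r ↔ r < μ.colLen c := fun r c => by
    rw [← YoungDiagram.mem_iff_lt_rowLen, YoungDiagram.mem_iff_lt_colLen]
  rw [← code_ne_U_iff, Ne, code_eq_U_iff]
  constructor
  · intro h
    have hex : ∃ r : ℕ, (μ.rowLen r : ℤ) - (r : ℤ) - 1 ≤ z := by
      refine ⟨(μ.rowLen 0 - z).toNat, ?_⟩
      have := μ.rowLen_anti 0 (μ.rowLen 0 - z).toNat (Nat.zero_le _)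
      omega
    classical
    have hr := Nat.find_spec hex
    have hlt : ∀ q < Nat.find hex, z < (μ.rowLen q : ℤ) - (q : ℤ) - 1 := fun q hq => by
      have := Nat.find_min hex hq
      omega
    generalize Nat.find hex = r at hr hlt
    have hne : z ≠ (μ.rowLen r : ℤ) - (r : ℤ) - 1 := fun e => h ⟨r, e⟩
    refine ⟨(z + r).toNat, ?_⟩
    have h1 : ¬ r < μ.colLen (z + r).toNat := by
      rw [← hmem]; omega
    have h2 : r ≤ μ.colLen (z + r).toNat := by
      rcases Nat.eq_zero_or_pos r with h0 | h0
      · omega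
      · have h3 := hlt (r - 1) (by omega)
        have h4 := (hmem (r - 1) (z + r).toNat).1 (by omega)
        omega
    omega
  · rintro ⟨c, hc⟩ ⟨r, hr⟩
    have := hmem r c
    omega

theorem rowStart_strictAnti (μ : YoungDiagram) :
    StrictAnti fun r : ℕ => (μ.rowLen r : ℤ) - (r : ℤ) - 1 := by
  intro a b hab
  have := μ.rowLen_anti a b hab.le
  simp only
  omega

theorem colStart_strictMono (μ : YoungDiagram) :
    StrictMono fun c : ℕ => (c : ℤ) - (μ.colLen c : ℤ) := by
  intro a b hab
  have := μ.colLen_anti a b hab.le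
  simp only
  omega

theorem exists_rowLen_eq_zero (μ : YoungDiagram) : ∃ N, ∀ r, N ≤ r → μ.rowLen r = 0 := by
  refine ⟨μ.colLen 0, fun r hr => ?_⟩
  by_contra h
  have h1 : (r, 0) ∈ μ := YoungDiagram.mem_iff_lt_rowLen.2 (Nat.pos_of_ne_zero h)
  have := YoungDiagram.mem_iff_lt_colLen.1 h1
  omega

theorem eq_of_rowLen_eq {μ ν : YoungDiagram} (h : ∀ r, μ.rowLen r = ν.rowLen r) : μ = ν := by
  ext ⟨r, c⟩
  simp only [YoungDiagram.mem_cells, YoungDiagram.mem_iff_lt_rowLen, h]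

/-- A partition is determined by its code up to a shift. -/
theorem eq_of_code_eq_shift {μ ν : YoungDiagram} (c : ℤ)
    (h : ∀ y, code μ y = code ν (y + c)) : μ = ν := by
  have hfun : (fun r : ℕ => (μ.rowLen r : ℤ) - (r : ℤ) - 1 + c) =
      fun r : ℕ => (ν.rowLen r : ℤ) - (r : ℤ) - 1 := by
    have h1 : StrictMono (OrderDual.toDual ∘
        fun r : ℕ => (μ.rowLen r : ℤ) - (r : ℤ) - 1 + c) := fun a b hab => by
      have := rowStart_strictAnti μ hab
      simp only [Function.comp, OrderDual.toDual_lt_toDual] at this ⊢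
      omega
    have h2 : StrictMono (OrderDual.toDual ∘
        fun r : ℕ => (ν.rowLen r : ℤ) - (r : ℤ) - 1) := fun a b hab => by
      have := rowStart_strictAnti ν hab
      simp only [Function.comp, OrderDual.toDual_lt_toDual] at this ⊢
      omega
    refine (h1.range_inj h2).1 ?_
    ext z
    have e1 := code_eq_U_iff μ (OrderDual.ofDual z - c)
    have e2 := code_eq_U_iff ν (OrderDual.ofDual z)
    rw [h, sub_add_cancel] at e1
    rw [e1] at e2
    constructor
    · rintro ⟨r, hr⟩
      obtain ⟨q, hq⟩ := e2.1 ⟨r, by rw [← hr]; simp⟩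
      exact ⟨q, by rw [Function.comp, ← hq]; rfl⟩
    · rintro ⟨r, hr⟩
      obtain ⟨q, hq⟩ := e2.2 ⟨r, by rw [← hr]; simp⟩
      refine ⟨q, ?_⟩
      rw [Function.comp, ← hq]; simp
  have hr : ∀ r : ℕ, (μ.rowLen r : ℤ) - (r : ℤ) - 1 + c = (ν.rowLen r : ℤ) - (r : ℤ) - 1 :=
    fun r => congrFun hfun r
  obtain ⟨M, hM⟩ := exists_rowLen_eq_zero μ
  obtain ⟨N, hN⟩ := exists_rowLen_eq_zero ν
  have h0 := hr (max M N)
  rw [hM _ (le_max_left _ _), hN _ (le_max_right _ _)] at h0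
  refine eq_of_rowLen_eq fun r => ?_
  have := hr r
  omega

/-- The place of the `i`-th `R` from the left. -/
theorem encard_R_le (μ : YoungDiagram) (c : ℕ) :
    {y : ℤ | y ≤ (c : ℤ) - (μ.colLen c : ℤ) ∧ code μ y = Step.R}.encard = ((c + 1 : ℕ) : ℕ∞) := by
  have : {y : ℤ | y ≤ (c : ℤ) - (μ.colLen c : ℤ) ∧ code μ y = Step.R} =
      (fun c : ℕ => (c : ℤ) - (μ.colLen c : ℤ)) '' (Finset.range (c + 1) : Set ℕ) := by
    ext y
    simp only [Set.mem_ofPred_eq, code_eq_R_iff, Set.mem_image, Finset.coe_range, Set.mem_Iio]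
    constructor
    · rintro ⟨h1, b, rfl⟩
      have := (colStart_strictMono μ).le_iff_le.1 h1
      exact ⟨b, by omega, rfl⟩
    · rintro ⟨b, hb, rfl⟩
      exact ⟨(colStart_strictMono μ).monotone (by omega), b, rfl⟩
  rw [this, (colStart_strictMono μ).injective.encard_image, Set.encard_coe_eq_coe_finsetCard,
    Finset.card_range]

/-- The row lengths of the turned partition: the first `j` rows lose a box and a row of length `m`
is inserted below them, where `j` is the number of rows of length more than `m`. -/
def turnRow (μ : YoungDiagram) (m r : ℕ) : ℕ :=
  if r < μ.colLen m then μ.rowLen r - 1 else if r = μ.colLen m then m else μ.rowLen (r - 1)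

theorem lt_rowLen_iff (μ : YoungDiagram) (r c : ℕ) : c < μ.rowLen r ↔ r < μ.colLen c := by
  rw [← YoungDiagram.mem_iff_lt_rowLen, YoungDiagram.mem_iff_lt_colLen]

theorem turnRow_anti (μ : YoungDiagram) (m : ℕ) {a b : ℕ} (hab : a ≤ b) :
    turnRow μ m b ≤ turnRow μ m a := by
  have h1 := μ.rowLen_anti a b hab
  have h2 := μ.rowLen_anti (a - 1) (b - 1) (by omega)
  have h3 := lt_rowLen_iff μ a m
  have h4 := lt_rowLen_iff μ (b - 1) m
  unfold turnRow
  split_ifs <;> omega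

/-- The turned partition, given by its row lengths. -/
def turnDiagram (μ : YoungDiagram) (m : ℕ) : YoungDiagram where
  cells := ((Finset.range (μ.colLen 0 + 1)) ×ˢ (Finset.range (turnRow μ m 0))).filter
    fun x => x.2 < turnRow μ m x.1
  isLowerSet := by
    rintro ⟨a, b⟩ ⟨a', b'⟩ h hx
    rw [Prod.mk_le_mk] at h
    simp only [Finset.coe_filter, Finset.mem_product, Finset.mem_range, Set.mem_ofPred_eq] at hx ⊢
    have := turnRow_anti μ m h.1
    omega

theorem rowLen_turnDiagram (μ : YoungDiagram) (m r : ℕ) :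
    (turnDiagram μ m).rowLen r = turnRow μ m r := by
  have key : ∀ c, c < (turnDiagram μ m).rowLen r ↔ c < turnRow μ m r := by
    intro c
    rw [← YoungDiagram.mem_iff_lt_rowLen, ← YoungDiagram.mem_cells]
    simp only [turnDiagram, Finset.mem_filter, Finset.mem_product, Finset.mem_range]
    refine ⟨fun h => h.2, fun h => ⟨⟨?_, lt_of_lt_of_le h (turnRow_anti μ m (Nat.zero_le r))⟩, h⟩⟩
    by_contra hr
    have h1 := μ.colLen_anti 0 m (Nat.zero_le _)
    have h2 := lt_rowLen_iff μ (r - 1) 0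
    unfold turnRow at h
    split_ifs at h <;> omega
  have h1 := key (turnRow μ m r)
  have h2 := key ((turnDiagram μ m).rowLen r)
  omega

theorem code_turnDiagram (μ : YoungDiagram) (m : ℕ) (y : ℤ) :
    code (turnDiagram μ m) y =
      Function.update (code μ) ((m : ℤ) - (μ.colLen m : ℤ)) Step.U (y + 1) := by
  have hiff : code (turnDiagram μ m) y = Step.U ↔
      Function.update (code μ) ((m : ℤ) - (μ.colLen m : ℤ)) Step.U (y + 1) = Step.U := by
    rw [code_eq_U_iff]
    by_cases hy : y + 1 = (m : ℤ) - (μ.colLen m : ℤ)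
    · rw [hy, Function.update_self]
      refine ⟨fun _ => rfl, fun _ => ⟨μ.colLen m, ?_⟩⟩
      rw [rowLen_turnDiagram, turnRow, if_neg (lt_irrefl _), if_pos rfl]
      omega
    · rw [Function.update_of_ne hy, code_eq_U_iff]
      constructor
      · rintro ⟨r, hr⟩
        have h3 := lt_rowLen_iff μ r m
        rw [rowLen_turnDiagram, turnRow] at hr
        split_ifs at hr with h1 h2
        · exact ⟨r, by omega⟩
        · omega
        · exact ⟨r - 1, by omega⟩
      · rintro ⟨r, hr⟩
        have h3 := lt_rowLen_iff μ r m
        by_cases h1 : r < μ.colLen m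
        · refine ⟨r, ?_⟩
          rw [rowLen_turnDiagram, turnRow, if_pos h1]
          omega
        · refine ⟨r + 1, ?_⟩
          rw [rowLen_turnDiagram, turnRow, if_neg (by omega), if_neg (by omega),
            Nat.add_sub_cancel]
          push_cast
          omega
  generalize Function.update (code μ) ((m : ℤ) - (μ.colLen m : ℤ)) Step.U (y + 1) = w at hiff
  cases w <;> cases h : code (turnDiagram μ m) y <;> simp_all

theorem isTurn_turnDiagram (μ : YoungDiagram) (i : ℕ+) :
    IsTurn μ i (turnDiagram μ ((i : ℕ) - 1)) := by
  refine ⟨(((i : ℕ) - 1 : ℕ) : ℤ) - (μ.colLen ((i : ℕ) - 1) : ℤ),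
    (code_eq_R_iff _ _).2 ⟨_, rfl⟩, ?_, 1, fun y => code_turnDiagram μ _ y⟩
  rw [encard_R_le, Nat.sub_add_cancel i.pos]

theorem eq_of_isTurn {μ ν : YoungDiagram} {i : ℕ+} (h : IsTurn μ i ν) :
    ν = turnDiagram μ ((i : ℕ) - 1) := by
  obtain ⟨z, hz, hcard, c, hc⟩ := h
  obtain ⟨m, rfl⟩ := (code_eq_R_iff _ _).1 hz
  rw [encard_R_le, Nat.cast_inj] at hcard
  rw [← hcard, Nat.add_sub_cancel]
  refine eq_of_code_eq_shift (c - 1) fun y => ?_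
  rw [hc, code_turnDiagram]
  congr 1
  ring

theorem existsUnique_isTurn (μ : YoungDiagram) (i : ℕ+) : ∃! ν, IsTurn μ i ν :=
  ⟨_, isTurn_turnDiagram μ i, fun _ h => eq_of_isTurn h⟩

/-- The partition `μ⁽ⁱ⁾` obtained by turning the `i`-th `R` from the left in the code of `μ`
into a `U`. -/
def turn (μ : YoungDiagram) (i : ℕ+) : YoungDiagram := (existsUnique_isTurn μ i).choose

end CarrellGoulden

end

noncomputable section
namespace CarrellGoulden

/-! ### The lowering operators -/

/-! The operator exp(-∑ u^k ∂/∂p_k) is the translation p_k ↦ p_k - u^k, hence a ring homomorphism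
(`lowerHom`). It multiplies the generating series of the h_n by 1 - ut, so it sends h_z to h_z - u
h_{z-1} (`lowerHom_complete`). Applied to a Jacobi-Trudi determinant det(h_{β_i+j}) of size N, it
yields a determinant whose u^m-coefficient is, up to sign, the minor of the N × (N+1) matrix
(h_{β_i-1+j}) without column m. Pairing these minors with h_{z+m} is a Laplace expansion. Thus B_z
puts a row z on top of the determinant and lowers every β_i by one (`coeff_bernstein_jacobiTrudi`).

For s_μ the lowered rows μ_r - r - 1 are exactly the places of U in the code. If z is such a place,
two rows agree and the coefficient vanishes. Otherwise z = c - μ'_c is the place of the (c+1)-st R,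
where μ' is the conjugate of μ. Sorting moves the new row past the μ'_c rows longer than c, which
gives the sign (-1)^{μ'_c} and the Schur function of the turned partition (`coeff_bernstein_schur`).
As |μ⁽ⁱ⁾| - |μ| = c - μ'_c with i = c + 1 (`card_turnDiagram`), signs and exponents are those of the
theorem. The exponents strictly increase with i, so the family is summable. -/

/-- The coefficient of `u ^ n` in `exp (-∑_{k ≥ 1} u ^ k ∂/∂p_k)`. -/
def lower (n : ℕ) : Module.End ℂ SymFun := PowerSeries.coeff n loweringSeries

/-- The power rule for the Euler operator X d/dX, which multiplies the n-th coefficient by n. Since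
the coefficients of `a` commute with each other, `a` commutes with its image `b`, and the
commutative argument goes through. -/
theorem natCast_mul_coeff_pow_succ {A : Type*} [Ring A] {a : PowerSeries A}
    (hc : ∀ j k, PowerSeries.coeff j a * PowerSeries.coeff k a =
      PowerSeries.coeff k a * PowerSeries.coeff j a) (m n : ℕ) :
    (n : A) * PowerSeries.coeff n (a ^ (m + 1)) = ((m + 1 : ℕ) : A) *
      PowerSeries.coeff n (PowerSeries.mk (fun k => (k : A) * PowerSeries.coeff k a) * a ^ m) := by
  set b := PowerSeries.mk (fun k => (k : A) * PowerSeries.coeff k a) with hb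
  have hba : b * a = a * b := by
    ext1 n
    rw [PowerSeries.coeff_mul, PowerSeries.coeff_mul, ← Finset.Nat.sum_antidiagonal_swap]
    refine Finset.sum_congr rfl fun p _ => ?_
    rw [hb, PowerSeries.coeff_mk, PowerSeries.coeff_mk, Prod.fst_swap, Prod.snd_swap, mul_assoc, hc,
      ← mul_assoc, Nat.cast_comm, mul_assoc]
  -- The Leibniz rule for the Euler operator on `a * f`.
  have hmul : ∀ (f : PowerSeries A) (n : ℕ), (n : A) * PowerSeries.coeff n (a * f) =
      PowerSeries.coeff n (b * f) +
        PowerSeries.coeff n (a * PowerSeries.mk fun k => (k : A) * PowerSeries.coeff k f) := by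
    intro f n
    simp only [PowerSeries.coeff_mul, Finset.mul_sum, ← Finset.sum_add_distrib, hb,
      PowerSeries.coeff_mk]
    refine Finset.sum_congr rfl fun p hp => ?_
    rw [← Finset.HasAntidiagonal.mem_antidiagonal.1 hp, Nat.cast_add, add_mul, mul_assoc,
      ← mul_assoc _ (p.2 : A), ← Nat.cast_comm, mul_assoc]
  induction m generalizing n with
  | zero => simp [hb]
  | succ m ih =>
    have h1 : (PowerSeries.mk fun k => (k : A) * PowerSeries.coeff k (a ^ (m + 1))) =
        PowerSeries.C ((m + 1 : ℕ) : A) * (b * a ^ m) := by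
      ext1 k
      rw [PowerSeries.coeff_mk, ih, PowerSeries.coeff_C_mul]
    rw [pow_succ', hmul, h1, map_natCast, ← mul_assoc, ← Nat.cast_comm, mul_assoc, ← mul_assoc a,
      ← hba, mul_assoc, ← pow_succ', ← map_natCast (PowerSeries.C (R := A)),
      PowerSeries.coeff_C_mul, Nat.cast_succ (m + 1), add_mul, one_mul, add_comm]

/-- The equation X (exp a)' = X a' · exp a, read off coefficientwise so that operator coefficients
are allowed. -/
theorem natCast_mul_coeff_formalExp {A : Type*} [Ring A] [Algebra ℂ A]
    {a : PowerSeries A} (ha : PowerSeries.constantCoeff a = 0)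
    (hc : ∀ j k, PowerSeries.coeff j a * PowerSeries.coeff k a =
      PowerSeries.coeff k a * PowerSeries.coeff j a) (n : ℕ) :
    (n : A) * PowerSeries.coeff n (formalExp a) =
      ∑ p ∈ Finset.HasAntidiagonal.antidiagonal n,
        (p.1 : A) * (PowerSeries.coeff p.1 a * PowerSeries.coeff p.2 (formalExp a)) := by
  have h1 : ∀ p ∈ Finset.HasAntidiagonal.antidiagonal n,
      (p.1 : A) * (PowerSeries.coeff p.1 a * PowerSeries.coeff p.2 (formalExp a)) =
      ∑ m ∈ Finset.range (n + 1), ((m.factorial : ℂ)⁻¹) •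
        ((p.1 : A) * PowerSeries.coeff p.1 a * PowerSeries.coeff p.2 (a ^ m)) := by
    intro p hp
    have hp := Finset.HasAntidiagonal.mem_antidiagonal.1 hp
    rw [coeff_formalExp ha (show p.2 ≤ n by omega), ← mul_assoc, Finset.mul_sum]
    exact Finset.sum_congr rfl fun m _ => by rw [mul_smul_comm]
  rw [Finset.sum_congr rfl h1, Finset.sum_comm, coeff_formalExp ha (Nat.le_succ n),
    Finset.sum_range_succ', mul_add]
  -- The term m = 0 drops out: a^0 has only a constant coefficient, and there the factor n is zero.
  have h0 : (n : A) * (((Nat.factorial 0 : ℂ)⁻¹) • PowerSeries.coeff n (a ^ 0)) = 0 := by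
    rcases Nat.eq_zero_or_pos n with rfl | hn
    · rw [Nat.cast_zero, zero_mul]
    · rw [pow_zero, PowerSeries.coeff_one, if_neg (by omega), smul_zero, mul_zero]
  rw [h0, add_zero, Finset.mul_sum]
  refine Finset.sum_congr rfl fun m _ => ?_
  have h5 : ((m + 1 : ℕ) : ℂ) ≠ 0 := by exact_mod_cast Nat.succ_ne_zero m
  rw [mul_smul_comm, natCast_mul_coeff_pow_succ hc, ← nsmul_eq_mul, ← Nat.cast_smul_eq_nsmul ℂ,
    smul_smul, ← Finset.smul_sum, PowerSeries.coeff_mul, Nat.factorial_succ, Nat.cast_mul, mul_inv,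
    mul_right_comm, inv_mul_cancel₀ h5, one_mul]
  simp only [PowerSeries.coeff_mk]

/-- The operator `∂/∂p_{k+1}`. -/
abbrev partialOp (k : ℕ) : Module.End ℂ SymFun :=
  ((MvPolynomial.pderiv k.succPNat : Derivation ℂ SymFun SymFun) : SymFun →ₗ[ℂ] SymFun)

/-- The commutator of two derivations is a derivation, so it is enough that it kills the variables.
-/
theorem partialOp_comm (j k : ℕ) : partialOp j * partialOp k = partialOp k * partialOp j := by
  have h : ⁅(MvPolynomial.pderiv j.succPNat : Derivation ℂ SymFun SymFun),
      (MvPolynomial.pderiv k.succPNat : Derivation ℂ SymFun SymFun)⁆ = 0 := by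
    refine MvPolynomial.derivation_ext fun i => ?_
    classical
    rw [Derivation.commutator_apply, MvPolynomial.pderiv_X, MvPolynomial.pderiv_X]
    simp only [Pi.single_apply]
    split_ifs <;> simp
  refine LinearMap.ext fun f => ?_
  have h1 := DFunLike.congr_fun h f
  rw [Derivation.commutator_apply] at h1
  exact sub_eq_zero.1 h1

theorem coeff_loweringExponent_zero : PowerSeries.coeff 0 loweringExponent = 0 := by
  simp [loweringExponent]

theorem coeff_loweringExponent_succ (k : ℕ) :
    PowerSeries.coeff (k + 1) loweringExponent = -partialOp k := by
  rw [loweringExponent, PowerSeries.coeff_mk, dif_pos (Nat.succ_pos k)]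
  rfl

theorem lower_zero : lower 0 = 1 := by
  rw [lower, loweringSeries, PowerSeries.coeff_zero_eq_constantCoeff_apply,
    constantCoeff_formalExp]

/-- Together with `lower_zero` this recursion determines every `lower n`, because n + 1 is not a
zero divisor; the later inductions on `lower` rest on it. The index p.1 stands for ∂/∂p_{p.1+1}. -/
theorem succ_mul_lower_succ_apply (n : ℕ) (f : SymFun) :
    ((n + 1 : ℕ) : SymFun) * lower (n + 1) f =
      -∑ p ∈ Finset.HasAntidiagonal.antidiagonal n,
        ((p.1 + 1 : ℕ) : SymFun) * MvPolynomial.pderiv p.1.succPNat (lower p.2 f) := by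
  have hc : ∀ j k, PowerSeries.coeff j loweringExponent * PowerSeries.coeff k loweringExponent =
      PowerSeries.coeff k loweringExponent * PowerSeries.coeff j loweringExponent := by
    intro j k
    cases j <;> cases k <;>
      simp only [coeff_loweringExponent_zero, coeff_loweringExponent_succ, zero_mul, mul_zero]
    exact (neg_mul_neg _ _).trans ((partialOp_comm _ _).trans (neg_mul_neg _ _).symm)
  have h := LinearMap.congr_fun (natCast_mul_coeff_formalExp (a := loweringExponent)
    ((PowerSeries.coeff_zero_eq_constantCoeff_apply _).symm.trans coeff_loweringExponent_zero)
    hc (n + 1)) f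
  rw [Finset.Nat.sum_antidiagonal_succ] at h
  simp only [coeff_loweringExponent_zero, zero_mul, mul_zero, zero_add, LinearMap.sum_apply,
    coeff_loweringExponent_succ, Module.End.mul_apply, LinearMap.neg_apply, map_neg,
    Finset.sum_neg_distrib, Module.End.natCast_apply, nsmul_eq_mul] at h
  exact h

theorem natCast_succ_ne_zero (n : ℕ) : ((n + 1 : ℕ) : SymFun) ≠ 0 :=
  Nat.cast_ne_zero.2 (Nat.succ_ne_zero n)

theorem lower_one {n : ℕ} (hn : 0 < n) : lower n 1 = 0 := by
  induction n using Nat.strong_induction_on with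
  | _ n ih =>
    obtain ⟨n, rfl⟩ := Nat.exists_eq_add_of_lt hn
    rw [zero_add] at ih ⊢
    refine (mul_eq_zero.1 ?_).resolve_left (natCast_succ_ne_zero n)
    rw [succ_mul_lower_succ_apply, neg_eq_zero]
    refine Finset.sum_eq_zero fun p hp => ?_
    have hp : p.1 + p.2 = n := by simpa using hp
    rcases Nat.eq_zero_or_pos p.2 with h | h
    · rw [h, lower_zero, Module.End.one_apply, MvPolynomial.pderiv_one, mul_zero]
    · rw [ih p.2 (by omega) h, map_zero, mul_zero]

/-- The generating series of `lower n f`: the result of applying `exp (-∑_{k ≥ 1} u ^ k ∂/∂p_k)`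
to `f`. -/
def lowerGen (f : SymFun) : PowerSeries SymFun := PowerSeries.mk fun n => lower n f

theorem coeff_lowerGen (n : ℕ) (f : SymFun) : PowerSeries.coeff n (lowerGen f) = lower n f :=
  PowerSeries.coeff_mk _ _

theorem derivative_lowerGen (f : SymFun) (n : ℕ) :
    PowerSeries.coeff n (PowerSeries.derivative SymFun (lowerGen f)) =
      -∑ p ∈ Finset.HasAntidiagonal.antidiagonal n,
        ((p.1 + 1 : ℕ) : SymFun) * MvPolynomial.pderiv p.1.succPNat (lower p.2 f) := by
  rw [PowerSeries.coeff_derivative, coeff_lowerGen, ← succ_mul_lower_succ_apply, mul_comm,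
    Nat.cast_succ]

theorem sum_antidiagonal_assoc {M : Type*} [AddCommMonoid M] (f : ℕ → ℕ → ℕ → M) (n : ℕ) :
    ∑ x ∈ Finset.HasAntidiagonal.antidiagonal n,
        ∑ y ∈ Finset.HasAntidiagonal.antidiagonal x.1, f y.1 y.2 x.2 =
      ∑ x ∈ Finset.HasAntidiagonal.antidiagonal n,
        ∑ y ∈ Finset.HasAntidiagonal.antidiagonal x.2, f x.1 y.1 y.2 := by
  rw [Finset.sum_sigma', Finset.sum_sigma']
  refine Finset.sum_nbij' (fun x => ⟨(x.2.1, x.2.2 + x.1.2), (x.2.2, x.1.2)⟩)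
    (fun x => ⟨(x.1.1 + x.2.1, x.2.2), (x.1.1, x.2.1)⟩) ?_ ?_ ?_ ?_ ?_
  · rintro ⟨⟨a, b⟩, ⟨c, d⟩⟩ h
    simp only [Finset.mem_sigma, Finset.HasAntidiagonal.mem_antidiagonal] at h ⊢
    obtain ⟨h1, h2⟩ := h
    exact ⟨by omega, trivial⟩
  · rintro ⟨⟨a, b⟩, ⟨c, d⟩⟩ h
    simp only [Finset.mem_sigma, Finset.HasAntidiagonal.mem_antidiagonal] at h ⊢
    obtain ⟨h1, h2⟩ := h
    exact ⟨by omega, trivial⟩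
  · rintro ⟨⟨a, b⟩, ⟨c, d⟩⟩ h
    simp only [Finset.mem_sigma, Finset.HasAntidiagonal.mem_antidiagonal] at h
    obtain ⟨h1, rfl⟩ := h
    rfl
  · rintro ⟨⟨a, b⟩, ⟨c, d⟩⟩ h
    simp only [Finset.mem_sigma, Finset.HasAntidiagonal.mem_antidiagonal] at h
    obtain ⟨h1, rfl⟩ := h
    rfl
  · rintro ⟨⟨a, b⟩, ⟨c, d⟩⟩ _
    rfl

/-- The triple convolution is regrouped with the index of the partial derivative outermost, the
shape in which the Leibniz rule applies in `lowerGen_mul`. -/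
theorem coeff_derivative_lowerGen_mul (f g : SymFun) (n : ℕ) :
    PowerSeries.coeff n (PowerSeries.derivative SymFun (lowerGen f) * lowerGen g) =
      -∑ p ∈ Finset.HasAntidiagonal.antidiagonal n, ((p.1 + 1 : ℕ) : SymFun) *
        ∑ q ∈ Finset.HasAntidiagonal.antidiagonal p.2,
          MvPolynomial.pderiv p.1.succPNat (lower q.1 f) * lower q.2 g := by
  simp only [PowerSeries.coeff_mul, derivative_lowerGen, coeff_lowerGen, neg_mul, Finset.sum_mul,
    Finset.sum_neg_distrib, Finset.mul_sum]
  rw [sum_antidiagonal_assoc fun a b c => ((a + 1 : ℕ) : SymFun) *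
    MvPolynomial.pderiv a.succPNat (lower b f) * lower c g]
  simp only [mul_assoc]

/-- Both sides satisfy the same differential equation in u, because each ∂/∂p_k is a derivation. The
equation determines coefficient n + 1 from the earlier ones. -/
theorem lowerGen_mul (f g : SymFun) : lowerGen (f * g) = lowerGen f * lowerGen g := by
  ext1 n
  induction n using Nat.strong_induction_on with
  | _ n ih =>
    cases n with
    | zero => simp [PowerSeries.coeff_mul, coeff_lowerGen, lower_zero]
    | succ n =>
      have h1 := PowerSeries.coeff_derivative (lowerGen (f * g)) n
      have h2 := PowerSeries.coeff_derivative (lowerGen f * lowerGen g) n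
      rw [← Nat.cast_succ] at h1 h2
      refine mul_right_cancel₀ (natCast_succ_ne_zero n) ?_
      rw [← h1, ← h2, derivative_lowerGen, Derivation.leibniz, smul_eq_mul, smul_eq_mul, map_add,
        mul_comm (lowerGen f), mul_comm (lowerGen g), coeff_derivative_lowerGen_mul,
        coeff_derivative_lowerGen_mul, ← neg_add, ← Finset.sum_add_distrib, neg_inj]
      refine Finset.sum_congr rfl fun p hp => ?_
      have hp := Finset.HasAntidiagonal.mem_antidiagonal.1 hp
      rw [← coeff_lowerGen, ih p.2 (by omega), PowerSeries.coeff_mul, map_sum, ← mul_add,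
        ← Finset.Nat.sum_antidiagonal_swap (n := p.2)
          (f := fun q => MvPolynomial.pderiv p.1.succPNat (lower q.1 g) * lower q.2 f),
        ← Finset.sum_add_distrib]
      congr 1
      refine Finset.sum_congr rfl fun q _ => ?_
      rw [Derivation.leibniz, smul_eq_mul, smul_eq_mul, coeff_lowerGen, coeff_lowerGen,
        Prod.fst_swap, Prod.snd_swap]
      ring

/-- The translation `f ↦ exp (-∑_{k ≥ 1} u ^ k ∂/∂p_k) f` as a ring homomorphism. -/
def lowerHom : SymFun →+* PowerSeries SymFun where
  toFun := lowerGen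
  map_one' := by
    ext1 n
    rw [coeff_lowerGen, PowerSeries.coeff_one]
    split_ifs with h
    · rw [h, lower_zero, Module.End.one_apply]
    · exact lower_one (Nat.pos_of_ne_zero h)
  map_mul' := lowerGen_mul
  map_zero' := by
    ext1 n
    rw [coeff_lowerGen, map_zero, map_zero]
  map_add' f g := by
    ext1 n
    rw [coeff_lowerGen, map_add, map_add, coeff_lowerGen, coeff_lowerGen]

theorem coeff_lowerHom (n : ℕ) (f : SymFun) : PowerSeries.coeff n (lowerHom f) = lower n f :=
  coeff_lowerGen n f

/-! ### Lowering the complete symmetric functions -/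

/-- Newton's identity, the coefficientwise form of `derivative_raisingSeries`. -/
theorem natCast_mul_complete (n : ℕ) :
    ((n + 1 : ℕ) : SymFun) * complete ((n + 1 : ℕ) : ℤ) =
      ∑ p ∈ Finset.range (n + 1), MvPolynomial.X p.succPNat * complete ((n : ℤ) - p) := by
  have h := congrArg (PowerSeries.coeff n) derivative_raisingSeries
  have hz : ∀ m : ℕ, PowerSeries.coeff m raisingSeries = complete m := fun m => by
    rw [complete, if_pos (by omega), Int.toNat_natCast]
  rw [PowerSeries.coeff_derivative, PowerSeries.coeff_mul, hz, ← Nat.cast_succ, mul_comm,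
    Finset.Nat.sum_antidiagonal_eq_sum_range_succ_mk] at h
  refine h.trans (Finset.sum_congr rfl fun p hp => ?_)
  have hp : p < n + 1 := Finset.mem_range.1 hp
  rw [PowerSeries.coeff_mk, hz, Nat.cast_sub (by omega)]

/-- `z h_z = ∑ p_j h_{z - j}`. -/
theorem intCast_mul_complete (z : ℤ) {N : ℕ} (hN : z ≤ N) :
    (z : SymFun) * complete z =
      ∑ p ∈ Finset.range N, MvPolynomial.X p.succPNat * complete (z - 1 - p) := by
  rcases le_or_gt z 0 with hz | hz
  · rw [Finset.sum_eq_zero fun p _ => by rw [complete_neg (by omega), mul_zero]]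
    rcases hz.eq_or_lt with rfl | hz
    · rw [Int.cast_zero, zero_mul]
    · rw [complete_neg hz, mul_zero]
  · obtain ⟨n, rfl⟩ : ∃ n : ℕ, z = ((n + 1 : ℕ) : ℤ) := ⟨(z - 1).toNat, by omega⟩
    rw [Int.cast_natCast, natCast_mul_complete]
    have h1 : ((n + 1 : ℕ) : ℤ) - 1 = n := by omega
    rw [h1]
    refine Finset.sum_subset (Finset.range_mono (by omega)) fun p _ hp => ?_
    rw [Finset.mem_range] at hp
    rw [complete_neg (by omega), mul_zero]

/-- On the generating series exp(∑ p_k t^k / k), ∂/∂p_k acts as multiplication by t^k / k. The proof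
differentiates Newton's identity and inducts on the degree. -/
theorem succ_mul_pderiv_complete (k : ℕ) (z : ℤ) :
    ((k + 1 : ℕ) : SymFun) * MvPolynomial.pderiv k.succPNat (complete z) =
      complete (z - ((k + 1 : ℕ) : ℤ)) := by
  rcases le_or_gt z 0 with hz | hz
  · rw [complete_neg (z := z - _) (by omega)]
    rcases hz.eq_or_lt with rfl | hz
    · rw [complete_zero, MvPolynomial.pderiv_one, mul_zero]
    · rw [complete_neg hz, map_zero, mul_zero]
  · obtain ⟨n, rfl⟩ := Int.eq_ofNat_of_zero_le hz.le
    induction n using Nat.strong_induction_on with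
    | _ n ih =>
      have hIH : ∀ p : ℕ, ((k + 1 : ℕ) : SymFun) *
          MvPolynomial.pderiv k.succPNat (complete ((n : ℤ) - 1 - p)) =
            complete ((n : ℤ) - ((k + 1 : ℕ) : ℤ) - 1 - p) := by
        intro p
        rcases le_or_gt ((n : ℤ) - 1 - p) 0 with h | h
        · rw [complete_neg (z := (n : ℤ) - ((k + 1 : ℕ) : ℤ) - 1 - p) (by omega)]
          rcases h.eq_or_lt with h | h
          · rw [h, complete_zero, MvPolynomial.pderiv_one, mul_zero]
          · rw [complete_neg h, map_zero, mul_zero]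
        · have h2 := ih (n - 1 - p) (by omega) (by omega)
          have h3 : ((n - 1 - p : ℕ) : ℤ) = (n : ℤ) - 1 - p := by omega
          rw [h3] at h2
          rw [h2]
          congr 1
          ring
      -- The range of length n + k + 1 serves Newton's identity both for h_n and for h_{n-k-1}, and
      -- it contains the index k of the variable being differentiated.
      have h1 := congrArg (MvPolynomial.pderiv k.succPNat)
        (intCast_mul_complete n (N := n + k + 1) (by omega))
      rw [Derivation.leibniz, map_sum, Int.cast_natCast, Derivation.map_natCast, smul_zero,
        add_zero, smul_eq_mul] at h1
      have h2 := intCast_mul_complete ((n : ℤ) - ((k + 1 : ℕ) : ℤ)) (N := n + k + 1) (by omega)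
      have h3 : ∀ p ∈ Finset.range (n + k + 1), ((k + 1 : ℕ) : SymFun) *
          MvPolynomial.pderiv k.succPNat
            (MvPolynomial.X p.succPNat * complete ((n : ℤ) - 1 - p)) =
          MvPolynomial.X p.succPNat * complete ((n : ℤ) - ((k + 1 : ℕ) : ℤ) - 1 - p) +
            if p = k then ((k + 1 : ℕ) : SymFun) * complete ((n : ℤ) - ((k + 1 : ℕ) : ℤ)) else 0 := by
        intro p _
        rw [Derivation.leibniz, smul_eq_mul, smul_eq_mul, ← hIH p]
        split_ifs with h
        · rw [h, MvPolynomial.pderiv_X_self]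
          have h4 : (n : ℤ) - 1 - k = n - ((k + 1 : ℕ) : ℤ) := by push_cast; ring
          rw [h4]
          ring
        · rw [MvPolynomial.pderiv_X_of_ne (fun e => h (Nat.succPNat_injective e))]
          ring
      have h5 : ((n : ℕ) : SymFun) ≠ 0 := Nat.cast_ne_zero.2 (by omega)
      refine mul_left_cancel₀ h5 ?_
      -- The two contributions are (n-k-1) h_{n-k-1} and (k+1) h_{n-k-1}, with sum n h_{n-k-1}.
      rw [mul_left_comm, h1, Finset.mul_sum, Finset.sum_congr rfl h3, Finset.sum_add_distrib, ← h2,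
        Finset.sum_ite_eq' (Finset.range (n + k + 1)), if_pos (Finset.mem_range.2 (by omega)),
        ← add_mul]
      congr 1
      push_cast
      ring

theorem lower_one_complete (z : ℤ) : lower 1 (complete z) = -complete (z - 1) := by
  have h := succ_mul_lower_succ_apply 0 (complete z)
  rw [Finset.Nat.antidiagonal_zero] at h
  have h2 := succ_mul_pderiv_complete 0 z
  simp only [Finset.sum_singleton, lower_zero, Module.End.one_apply, h2] at h
  simpa using h

/-- Only `lower 0` and `lower 1` survive on the right of the recursion, and their contributions are
h_{z-n} and -h_{z-n}. -/
theorem lower_complete_of_two_le {n : ℕ} (hn : 2 ≤ n) (z : ℤ) : lower n (complete z) = 0 := by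
  induction n using Nat.strong_induction_on with
  | _ n ih =>
    obtain ⟨n, rfl⟩ := Nat.exists_eq_add_of_le' hn
    refine (mul_eq_zero.1 ?_).resolve_left (natCast_succ_ne_zero (n + 1))
    rw [succ_mul_lower_succ_apply, neg_eq_zero, Finset.Nat.sum_antidiagonal_succ',
      Finset.Nat.sum_antidiagonal_eq_sum_range_succ_mk, Finset.sum_range_succ,
      Finset.sum_eq_zero]
    · simp only [Nat.sub_self, lower_zero, Module.End.one_apply, zero_add, lower_one_complete,
        map_neg, mul_neg, succ_mul_pderiv_complete]
      rw [add_neg_eq_zero]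
      congr 1
      push_cast
      ring
    · intro p hp
      rw [Finset.mem_range] at hp
      simp only
      rw [ih (n - p + 1) (by omega) (by omega), map_zero, mul_zero]

theorem lowerHom_complete (z : ℤ) :
    lowerHom (complete z) =
      PowerSeries.C (complete z) - PowerSeries.X * PowerSeries.C (complete (z - 1)) := by
  ext1 n
  rw [coeff_lowerHom, map_sub, PowerSeries.coeff_C]
  rcases n with _ | _ | n
  · simp [lower_zero]
  · rw [zero_add, lower_one_complete, if_neg one_ne_zero, ← zero_add 1,
      PowerSeries.coeff_succ_X_mul, PowerSeries.coeff_C, if_pos rfl, zero_sub, zero_add]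
  · rw [lower_complete_of_two_le (by omega), if_neg (by omega), PowerSeries.coeff_succ_X_mul,
      PowerSeries.coeff_C, if_neg (by omega), sub_zero]

/-! ### The Bernstein operators on Schur functions -/

theorem coeff_ofPowerSeries_raisingSeries (z : ℤ) :
    (HahnSeries.ofPowerSeries ℤ SymFun raisingSeries).coeff z = complete z := by
  rw [PowerSeries.coeff_coe, complete]
  split_ifs with h1 h2 h2
  · omega
  · rfl
  · rw [show z.natAbs = z.toNat by omega]
  · omega

/-- As a finite sum of monomials, `lowering f` can be multiplied by the raising series term by term.
-/
theorem lowering_eq_sum {f : SymFun} {N : ℕ} (hN : ∀ n, N < n → lower n f = 0) :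
    lowering f = ∑ m ∈ Finset.range (N + 1), HahnSeries.single (-(m : ℤ)) (lower m f) := by
  ext1
  ext1 z
  rw [HahnSeries.coeff_sum]
  rw [lowering]
  change (if z ≤ 0 then lower (-z).toNat f else 0) = _
  split_ifs with hz
  · obtain ⟨n, rfl⟩ : ∃ n : ℕ, z = -(n : ℤ) := ⟨(-z).toNat, by omega⟩
    rw [neg_neg, Int.toNat_natCast]
    by_cases hn : n ≤ N
    · rw [Finset.sum_eq_single n, HahnSeries.coeff_single_same]
      · intro m _ hm
        exact HahnSeries.coeff_single_of_ne (by omega)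
      · intro h
        exact absurd (Finset.mem_range.2 (by omega)) h
    · rw [hN n (by omega), Finset.sum_eq_zero]
      intro m hm
      rw [Finset.mem_range] at hm
      exact HahnSeries.coeff_single_of_ne (by omega)
  · rw [Finset.sum_eq_zero]
    intro m _
    exact HahnSeries.coeff_single_of_ne (by omega)

theorem coeff_bernstein {f : SymFun} {N : ℕ} (hN : ∀ n, N < n → lower n f = 0) (z : ℤ) :
    (bernstein f).coeff z = ∑ m ∈ Finset.range (N + 1), complete (z + m) * lower m f := by
  rw [bernstein, lowering_eq_sum hN, Finset.mul_sum, HahnSeries.coeff_sum]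
  refine Finset.sum_congr rfl fun m _ => ?_
  rw [HahnSeries.coeff_mul_single, coeff_ofPowerSeries_raisingSeries, sub_neg_eq_add]

/-- Expanding `det (b_{i,j+1} - X b_{i,j})` in powers of `X` gives the maximal minors of `b`. -/
theorem coeff_det_sub_X_mul {R : Type*} [CommRing R] {N : ℕ} (b : Fin N → Fin (N + 1) → R) (m : ℕ) :
    PowerSeries.coeff m (Matrix.of fun i j : Fin N =>
      PowerSeries.C (b i j.succ) - PowerSeries.X * PowerSeries.C (b i j.castSucc)).det =
    if h : m < N + 1 then (-1) ^ m * (Matrix.of fun i j : Fin N =>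
      b i ((⟨m, h⟩ : Fin (N + 1)).succAbove j)).det else 0 := by
  -- `Q` is `b` bordered by the top row 1, X, …, X^N. Subtracting X times the preceding column from
  -- each column turns it into `P`, whose top row is 1, 0, …, 0.
  let Q : Matrix (Fin (N + 1)) (Fin (N + 1)) (PowerSeries R) := Matrix.of fun i j =>
    Fin.cases (PowerSeries.X ^ (j : ℕ)) (fun i' => PowerSeries.C (b i' j)) i
  let P : Matrix (Fin (N + 1)) (Fin (N + 1)) (PowerSeries R) := Matrix.of fun i j =>
    Fin.cases (Fin.cases (Q i 0) (fun j' => Q i j'.succ - PowerSeries.X * Q i j'.castSucc) j)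
      (fun _ => Fin.cases (Q i 0) (fun j' => Q i j'.succ - PowerSeries.X * Q i j'.castSucc) j) i
  have hQP : Q.det = P.det := by
    refine Matrix.det_eq_of_forall_col_eq_smul_add_pred (fun _ => PowerSeries.X) ?_ ?_
    · intro i
      cases i using Fin.cases <;> rfl
    · intro i j
      cases i using Fin.cases <;> simp [P]
  have hP : P.det = (Matrix.of fun i j : Fin N =>
      PowerSeries.C (b i j.succ) - PowerSeries.X * PowerSeries.C (b i j.castSucc)).det := by
    rw [Matrix.det_succ_row_zero, Fin.sum_univ_succ, Finset.sum_eq_zero, add_zero]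
    · have h0 : P 0 0 = 1 := by simp [P, Q]
      rw [h0, Fin.val_zero, pow_zero, one_mul, one_mul]
      congr 1
    · intro j _
      have h0 : P 0 j.succ = 0 := by simp [P, Q, pow_succ']
      rw [h0, mul_zero, zero_mul]
  -- Expansion of `Q` along its top row separates the powers of X, since all other rows are
  -- constant.
  rw [← hP, ← hQP, Matrix.det_succ_row_zero, map_sum]
  have hj : ∀ j : Fin (N + 1), PowerSeries.coeff m ((-1) ^ (j : ℕ) * Q 0 j *
      (Q.submatrix Fin.succ j.succAbove).det) = if m = j then (-1) ^ m * (Matrix.of fun i k : Fin N =>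
      b i (j.succAbove k)).det else 0 := by
    intro j
    have h1 : (Q.submatrix Fin.succ j.succAbove).det =
        PowerSeries.C (Matrix.of fun i k : Fin N => b i (j.succAbove k)).det := by
      rw [RingHom.map_det]
      rfl
    have h2 : Q 0 j = PowerSeries.X ^ (j : ℕ) := rfl
    have h3 : ((-1 : PowerSeries R)) ^ (j : ℕ) = PowerSeries.C ((-1) ^ (j : ℕ)) := by simp
    rw [h1, h2, h3, mul_right_comm, ← map_mul, PowerSeries.coeff_C_mul, PowerSeries.coeff_X_pow]
    split_ifs with h
    · rw [mul_one, h]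
    · rw [mul_zero]
  simp only [hj]
  split_ifs with h
  · rw [Finset.sum_eq_single (⟨m, h⟩ : Fin (N + 1)), if_pos rfl]
    · intro j _ hne
      exact if_neg fun e => hne (Fin.ext e.symm)
    · intro h'
      exact absurd (Finset.mem_univ _) h'
  · refine Finset.sum_eq_zero fun j _ => if_neg ?_
    have := j.isLt
    omega

/-- The Jacobi-Trudi determinant `det (h_{β_i + j})` for any sequence `β` of integers. -/
def jacobiTrudi (n : ℕ) (β : Fin n → ℤ) : SymFun :=
  (Matrix.of fun i j : Fin n => complete (β i + j)).det

/-- A ring homomorphism acts on a determinant entrywise. The shift to β_i - 1 provides the extra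
column 0, the original columns being 1, …, N. -/
theorem lower_jacobiTrudi {N : ℕ} (β : Fin N → ℤ) (m : ℕ) :
    lower m (jacobiTrudi N β) = if h : m < N + 1 then (-1) ^ m * (Matrix.of fun i j : Fin N =>
      complete (β i - 1 + ((⟨m, h⟩ : Fin (N + 1)).succAbove j : ℕ))).det else 0 := by
  rw [← coeff_det_sub_X_mul (fun i (j : Fin (N + 1)) => complete (β i - 1 + (j : ℕ))) m,
    ← coeff_lowerHom, jacobiTrudi, RingHom.map_det]
  congr 2
  refine Matrix.ext fun i j => ?_
  rw [RingHom.mapMatrix_apply, Matrix.map_apply, Matrix.of_apply, Matrix.of_apply,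
    lowerHom_complete, Fin.val_succ, Fin.val_castSucc,
    show β i - 1 + ((j + 1 : ℕ) : ℤ) = β i + (j : ℕ) by push_cast; ring,
    show β i - 1 + ((j : ℕ) : ℤ) = β i + (j : ℕ) - 1 by ring]

/-- The Bernstein operator `B_z` adds a row to a Jacobi-Trudi determinant. -/
theorem coeff_bernstein_jacobiTrudi {N : ℕ} (β : Fin N → ℤ) (z : ℤ) :
    (bernstein (jacobiTrudi N β)).coeff z =
      jacobiTrudi (N + 1) (Fin.cons z fun i => β i - 1) := by
  -- The sum over m becomes the Laplace expansion along the new top row h_z, …, h_{z+N}.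
  rw [coeff_bernstein (N := N) (fun n hn => by rw [lower_jacobiTrudi, dif_neg (by omega)]),
    Finset.sum_range, jacobiTrudi.eq_1 (N + 1), Matrix.det_succ_row_zero]
  refine Finset.sum_congr rfl fun j _ => ?_
  rw [lower_jacobiTrudi, dif_pos j.isLt, Matrix.of_apply, Fin.cons_zero, mul_left_comm, mul_assoc]
  rfl

/-! ### Straightening -/

theorem schur_eq_jacobiTrudi (μ : YoungDiagram) {n : ℕ} (hn : μ.colLen 0 ≤ n) :
    schur μ = jacobiTrudi n fun i => (μ.rowLen i : ℤ) - (i : ℤ) :=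
  schur_eq_det μ hn

theorem jacobiTrudi_eq_zero {n : ℕ} {β : Fin n → ℤ} {i j : Fin n} (hij : i ≠ j)
    (h : β i = β j) : jacobiTrudi n β = 0 := by
  refine Matrix.det_zero_of_row_eq hij ?_
  ext1 k
  rw [Matrix.of_apply, Matrix.of_apply, h]

theorem jacobiTrudi_comp_perm {n : ℕ} (β : Fin n → ℤ) (σ : Equiv.Perm (Fin n)) :
    jacobiTrudi n (β ∘ σ) = Equiv.Perm.sign σ * jacobiTrudi n β :=
  Matrix.det_permute σ (Matrix.of fun i j : Fin n => complete (β i + j))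

theorem coeff_bernstein_schur_eq_zero (μ : YoungDiagram) {z : ℤ} (hz : code μ z = Step.U) :
    (bernstein (schur μ)).coeff z = 0 := by
  obtain ⟨r, hr⟩ := (code_eq_U_iff μ z).1 hz
  -- The size exceeds r, so that row r occurs in the determinant even when it is a zero row of μ.
  rw [schur_eq_jacobiTrudi μ (le_max_left (μ.colLen 0) (r + 1)), coeff_bernstein_jacobiTrudi]
  have hlt : r < max (μ.colLen 0) (r + 1) := by omega
  refine jacobiTrudi_eq_zero (i := 0) (j := Fin.succ ⟨r, hlt⟩) (Fin.succ_ne_zero _).symm ?_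
  rw [Fin.cons_zero, Fin.cons_succ, hr]

theorem colLen_turnDiagram_zero_le (μ : YoungDiagram) (c : ℕ) :
    (turnDiagram μ c).colLen 0 ≤ μ.colLen 0 + 1 := by
  by_contra h
  have h1 := (lt_rowLen_iff (turnDiagram μ c) (μ.colLen 0 + 1) 0).2 (by omega)
  have h2 := lt_rowLen_iff μ (μ.colLen 0) 0
  have h3 := μ.colLen_anti 0 c (Nat.zero_le c)
  rw [rowLen_turnDiagram, turnRow, if_neg (by omega), if_neg (by omega), Nat.add_sub_cancel] at h1
  omega

/-- The new row belongs below the μ'_c rows longer than c, and a cycle on μ'_c + 1 rows takes it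
there. -/
theorem coeff_bernstein_schur (μ : YoungDiagram) (c : ℕ) :
    (bernstein (schur μ)).coeff ((c : ℤ) - (μ.colLen c : ℤ)) =
      (-1) ^ μ.colLen c * schur (turnDiagram μ c) := by
  have hc : μ.colLen c < μ.colLen 0 + 1 := by
    have := μ.colLen_anti 0 c (Nat.zero_le c)
    omega
  rw [schur_eq_jacobiTrudi μ le_rfl, coeff_bernstein_jacobiTrudi,
    schur_eq_jacobiTrudi _ (colLen_turnDiagram_zero_le μ c)]
  set k : Fin (μ.colLen 0 + 1) := ⟨μ.colLen c, hc⟩ with hk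
  -- The inverse of `k.cycleRange` sends 0 to k and i + 1 to `k.succAbove i`: the top row goes to
  -- place k and the others keep their order.
  have hβ : (Fin.cons ((c : ℤ) - (μ.colLen c : ℤ)) fun i : Fin (μ.colLen 0) =>
      (μ.rowLen i : ℤ) - (i : ℤ) - 1 : Fin (μ.colLen 0 + 1) → ℤ) =
      (fun i : Fin (μ.colLen 0 + 1) => ((turnDiagram μ c).rowLen i : ℤ) - (i : ℤ)) ∘
        (k.cycleRange.symm : Equiv.Perm (Fin (μ.colLen 0 + 1))) := by
    ext1 i
    cases i using Fin.cases with
    | zero =>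
      rw [Fin.cons_zero, Function.comp_apply, Fin.cycleRange_symm_zero, rowLen_turnDiagram, turnRow,
        if_neg (lt_irrefl _), if_pos rfl]
    | succ i =>
      rw [Fin.cons_succ, Function.comp_apply, Fin.cycleRange_symm_succ, rowLen_turnDiagram, turnRow]
      -- Rows above place μ'_c are longer than c, hence nonempty, so the truncated subtraction in
      -- `turnRow` is exact.
      have h3 := lt_rowLen_iff μ i c
      rcases lt_or_ge (i : ℕ) (μ.colLen c) with h | h
      · rw [Fin.succAbove_of_castSucc_lt _ _ (show i.castSucc < k from h), Fin.val_castSucc,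
          if_pos h]
        omega
      · rw [Fin.succAbove_of_le_castSucc _ _ (show k ≤ i.castSucc from h), Fin.val_succ,
          if_neg (by omega), if_neg (by omega), Nat.add_sub_cancel]
        push_cast
        ring
  rw [hβ, jacobiTrudi_comp_perm, Equiv.Perm.sign_symm, Fin.sign_cycleRange]
  push_cast
  rfl

/-! ### The summable family -/

theorem card_eq_sum_rowLen (μ : YoungDiagram) {n : ℕ} (hn : μ.colLen 0 ≤ n) :
    μ.card = ∑ r ∈ Finset.range n, μ.rowLen r := by
  rw [YoungDiagram.card, Finset.card_eq_sum_card_fiberwise (f := Prod.fst)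
    (t := Finset.range n)]
  · refine Finset.sum_congr rfl fun r _ => ?_
    rw [YoungDiagram.rowLen_eq_card]
    rfl
  · intro x hx
    have h1 : (x.1, x.2) ∈ μ := hx
    have h2 := YoungDiagram.mem_iff_lt_colLen.1 h1
    have h3 := μ.colLen_anti 0 x.2 (Nat.zero_le _)
    exact Finset.mem_coe.2 (Finset.mem_range.2 (by omega))

/-- Up to row μ'_c - 1 each row loses one box; from row μ'_c on, the inserted row has added c boxes
and the index is shifted by one. -/
theorem sum_turnRow (μ : YoungDiagram) (c n : ℕ) :
    (∑ r ∈ Finset.range (n + 1), (turnRow μ c r : ℤ)) =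
      if n < μ.colLen c then (∑ r ∈ Finset.range (n + 1), (μ.rowLen r : ℤ)) - (n + 1)
      else (∑ r ∈ Finset.range n, (μ.rowLen r : ℤ)) + c - μ.colLen c := by
  induction n with
  | zero =>
    have h3 := lt_rowLen_iff μ 0 c
    rw [Finset.sum_range_one, Finset.sum_range_one, Finset.sum_range_zero, turnRow]
    split_ifs <;> omega
  | succ n ih =>
    have h3 := lt_rowLen_iff μ (n + 1) c
    rw [Finset.sum_range_succ, ih, turnRow, Nat.add_sub_cancel, Finset.sum_range_succ _ (n + 1),
      Finset.sum_range_succ _ n]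
    split_ifs <;> push_cast <;> omega

theorem card_turnDiagram (μ : YoungDiagram) (c : ℕ) :
    ((turnDiagram μ c).card : ℤ) - (μ.card : ℤ) = (c : ℤ) - (μ.colLen c : ℤ) := by
  have h1 := μ.colLen_anti 0 c (Nat.zero_le c)
  rw [card_eq_sum_rowLen _ (colLen_turnDiagram_zero_le μ c), card_eq_sum_rowLen μ le_rfl]
  simp only [rowLen_turnDiagram]
  push_cast
  rw [sum_turnRow, if_neg (by omega)]
  ring

theorem turn_eq_turnDiagram (μ : YoungDiagram) (i : ℕ+) :
    turn μ i = turnDiagram μ ((i : ℕ) - 1) :=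
  eq_of_isTurn (existsUnique_isTurn μ i).choose_spec.1

/-- The family `(t ^ (c - μ'_c) a_c)`, indexed by `c = i - 1`, where `μ'` is the conjugate of `μ`. -/
def colStartFamily (μ : YoungDiagram) (a : ℕ+ → SymFun) :
    HahnSeries.SummableFamily ℤ SymFun ℕ+ where
  toFun i := HahnSeries.single ((((i : ℕ) - 1 : ℕ) : ℤ) - (μ.colLen ((i : ℕ) - 1) : ℤ)) (a i)
  isPWO_iUnion_support' := by
    refine (BddBelow.isWF ⟨-(μ.colLen 0 : ℤ), ?_⟩).isPWO
    rintro z hz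
    obtain ⟨i, hi⟩ := Set.mem_iUnion.1 hz
    rw [Set.mem_singleton_iff.1 (HahnSeries.support_single_subset hi)]
    have := μ.colLen_anti 0 ((i : ℕ) - 1) (Nat.zero_le _)
    omega
  finite_co_support' z := by
    -- The exponents strictly increase with i, so at most one member has a nonzero coefficient at z.
    refine Set.Subsingleton.finite fun i hi j hj => ?_
    have h : ∀ k : ℕ+, (HahnSeries.single ((((k : ℕ) - 1 : ℕ) : ℤ) -
        (μ.colLen ((k : ℕ) - 1) : ℤ)) (a k)).coeff z ≠ 0 →
        z = (((k : ℕ) - 1 : ℕ) : ℤ) - (μ.colLen ((k : ℕ) - 1) : ℤ) := by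
      intro k hk
      by_contra hne
      exact hk (HahnSeries.coeff_single_of_ne hne)
    have h1 := (colStart_strictMono μ).injective ((h i hi).symm.trans (h j hj))
    have h2 := i.pos
    have h3 := j.pos
    exact PNat.eq (by omega)

theorem colStartFamily_apply (μ : YoungDiagram) (a : ℕ+ → SymFun) (i : ℕ+) :
    colStartFamily μ a i =
      HahnSeries.single ((((i : ℕ) - 1 : ℕ) : ℤ) - (μ.colLen ((i : ℕ) - 1) : ℤ)) (a i) :=
  rfl

end CarrellGoulden

end

theorem theorem1 (μ : YoungDiagram) :
    ∃ F : HahnSeries.SummableFamily ℤ CarrellGoulden.SymFun ℕ+,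
      (∀ i : ℕ+, F i =
        HahnSeries.single (((CarrellGoulden.turn μ i).card : ℤ) - (μ.card : ℤ))
          (((-1 : ℂ) ^ ((μ.card : ℤ) - ((CarrellGoulden.turn μ i).card : ℤ) + ((i : ℕ) : ℤ) - 1)) •
            CarrellGoulden.schur (CarrellGoulden.turn μ i))) ∧
      CarrellGoulden.bernstein (CarrellGoulden.schur μ) = F.hsum := by
  have hsign : ∀ i : ℕ+, (-1 : ℂ) ^ ((μ.card : ℤ) - ((CarrellGoulden.turn μ i).card : ℤ) +
      ((i : ℕ) : ℤ) - 1) • CarrellGoulden.schur (CarrellGoulden.turn μ i) =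
      (-1) ^ μ.colLen ((i : ℕ) - 1) *
        CarrellGoulden.schur (CarrellGoulden.turnDiagram μ ((i : ℕ) - 1)) := by
    intro i
    have h1 := CarrellGoulden.card_turnDiagram μ ((i : ℕ) - 1)
    have h2 := i.pos
    rw [CarrellGoulden.turn_eq_turnDiagram]
    -- With c = i - 1 the integer exponent of the sign equals μ'_c, so it is a natural number.
    have h3 : (μ.card : ℤ) - ((CarrellGoulden.turnDiagram μ ((i : ℕ) - 1)).card : ℤ) +
        ((i : ℕ) : ℤ) - 1 = (μ.colLen ((i : ℕ) - 1) : ℤ) := by omega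
    rw [h3, zpow_natCast, Algebra.smul_def, map_pow, map_neg, map_one]
  refine ⟨CarrellGoulden.colStartFamily μ fun i => (-1) ^ μ.colLen ((i : ℕ) - 1) *
    CarrellGoulden.schur (CarrellGoulden.turnDiagram μ ((i : ℕ) - 1)), fun i => ?_, ?_⟩
  · rw [CarrellGoulden.colStartFamily_apply, hsign, CarrellGoulden.turn_eq_turnDiagram,
      CarrellGoulden.card_turnDiagram]
  · ext1
    ext1 z
    rw [HahnSeries.SummableFamily.coeff_hsum]
    simp only [CarrellGoulden.colStartFamily_apply]
    -- At a U both coefficients vanish; at the R below column c exactly the member i = c + 1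
    -- contributes.
    cases hz : CarrellGoulden.code μ z with
    | U =>
      rw [CarrellGoulden.coeff_bernstein_schur_eq_zero μ hz, finsum_eq_zero_of_forall_eq_zero]
      intro i
      refine HahnSeries.coeff_single_of_ne fun h => ?_
      have := (CarrellGoulden.code_eq_R_iff μ z).2 ⟨_, h⟩
      rw [hz] at this
      cases this
    | R =>
      obtain ⟨c, rfl⟩ := (CarrellGoulden.code_eq_R_iff μ z).1 hz
      rw [CarrellGoulden.coeff_bernstein_schur, finsum_eq_single _ c.succPNat]
      · rw [Nat.succPNat_coe, Nat.succ_sub_one, HahnSeries.coeff_single_same]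
      · intro i hi
        refine HahnSeries.coeff_single_of_ne fun h => hi (PNat.eq ?_)
        have h1 := (CarrellGoulden.colStart_strictMono μ).injective h
        have h2 := i.pos
        rw [Nat.succPNat_coe]
        omega
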